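/- Let $L = a_r \partial^r + \cdots + a_1 \partial + a_0$, with $\partial = \mathrm d/\mathrm dx$ and $a_0, \dots, a_r \in \mathbb{Q}[x]$, be a linear differential operator of order $r$ such that $a_r(x) \neq 0$ for all $x \in [-1,1]$. Let $\mathbb{Q}(n)\langle S, S^{-1}\rangle$ be the skew Laurent polynomial ring with $S\,f(n) = f(n+1)\,S$, and put \[ I = \frac{1}{2n}(S^{-1} - S), \qquad \delta_r(n) = 2^r \prod_{i=-r+1}^{r-1} (n-i). \] Write $L = \sum_{i=0}^r \partial^i p_i(x)$ with $p_i \in \mathbb{Q}[x]$. The Chebyshev recurrence operator of $L$ is \[ P = \delta_r(n) \sum_{i=0}^r I^{\,r-i}\, p_i\bigl(\tfrac12(S+S^{-1})\bigr) = \sum_k b_k(n) S^k . \] Let $s$ be the half-order of $P$, that is, the largest $|k|$ with $b_k \neq 0$. The Newton polygon of $P$ is the lower convex hull of the points $p_k = (k, -\deg b_k)$, $b_k \neq 0$. To each of its edges $[p_i, p_j]$ $(i<j)$ one attaches the characteristic polynomial \[ \chi_i(\alpha) = \sum_{k \,:\, p_k \in [p_i,p_j]} \operatorname{lc}(b_k)\,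 \alpha^{k-i}, \] where $\operatorname{lc}$ denotes the leading coefficient. Proposition. The characteristic polynomials have $2s$ complex roots in total, counted with multiplicities. Let $\alpha_s, \dots, \alpha_1, \alpha_{-1}, \dots, \alpha_{-s}$ be any enumeration of them in which the edges are taken from left to right (that is, by increasing slope) and the roots belonging to the same edge are listed by nondecreasing modulus, and let $\kappa_i$ be the slope of the edge to which $\alpha_i$ belongs. Then, for all $i \in \{\pm 1, \dots, \pm s\}$, \[ \kappa_{-i} = -\kappa_i \qquad\text{and}\qquad |\alpha_{-i}| = |\alpha_i|^{-1}. \] Moreover, no root belonging to the horizontal edge (if there is one) has modulus $1$: if $\kappa_i = 0$, then $|\alpha_i| \neq 1$. -/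

import Mathlib

open Polynomial

noncomputable section

namespace ChebyshevRecurrence

/-- The automorphism `f(n) ↦ f(n + k)` of `ℚ(n)`. -/
def shift (k : ℤ) : RatFunc ℚ →+* RatFunc ℚ :=
  RatFunc.mapRingHom (algEquivAevalXAddC (k : ℚ))
    (nonZeroDivisors_le_comap_nonZeroDivisors_of_injective _
      (algEquivAevalXAddC (k : ℚ)).injective)

theorem shift_algebraMap (k : ℤ) (p : ℚ[X]) :
    shift k (algebraMap ℚ[X] (RatFunc ℚ) p) =
      algebraMap ℚ[X] (RatFunc ℚ) (p.comp (X + C (k : ℚ))) := by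
  have h := RatFunc.map_apply_div (algEquivAevalXAddC (k : ℚ))
    (nonZeroDivisors_le_comap_nonZeroDivisors_of_injective _
      (algEquivAevalXAddC (k : ℚ)).injective) p 1
  simp only [map_one, div_one] at h
  rw [shift, RatFunc.coe_mapRingHom_eq_coe_map, h]
  rfl

theorem ringHom_ratFunc_ext {f g : RatFunc ℚ →+* RatFunc ℚ}
    (h : ∀ p : ℚ[X], f (algebraMap _ _ p) = g (algebraMap _ _ p)) : f = g :=
  IsLocalization.ringHom_ext (nonZeroDivisors ℚ[X]) (RingHom.ext h)

theorem shift_zero : shift 0 = RingHom.id _ :=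
  ringHom_ratFunc_ext fun p => by simp [shift_algebraMap]

theorem shift_add (k l : ℤ) : shift (k + l) = (shift k).comp (shift l) :=
  ringHom_ratFunc_ext fun p => by
    simp [shift_algebraMap, comp_assoc, add_assoc]

/-- The group `{S ^ k}` acts on `ℚ(n)` by shifts. -/
instance : MulSemiringAction (Multiplicative ℤ) (RatFunc ℚ) where
  smul g f := shift g.toAdd f
  one_smul f := DFunLike.congr_fun shift_zero f
  mul_smul g h f := DFunLike.congr_fun (shift_add g.toAdd h.toAdd) f
  smul_zero g := map_zero (shift g.toAdd)
  smul_add g := map_add (shift g.toAdd)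
  smul_one g := map_one (shift g.toAdd)
  smul_mul g := map_mul (shift g.toAdd)

theorem smul_def (g : Multiplicative ℤ) (f : RatFunc ℚ) : g • f = shift g.toAdd f := rfl

/-- The skew Laurent polynomial ring `ℚ(n)⟨S, S⁻¹⟩`, with `S ^ k * f(n) = f(n + k) * S ^ k`. -/
abbrev RecOp : Type := SkewMonoidAlgebra (RatFunc ℚ) (Multiplicative ℤ)

/-- The power `S ^ k` of the shift, for `k : ℤ`. -/
def shiftPow (k : ℤ) : RecOp := SkewMonoidAlgebra.single (Multiplicative.ofAdd k) 1

/-- An element of `ℚ(n)` viewed as an operator of order zero. -/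
def ofRat (f : RatFunc ℚ) : RecOp := SkewMonoidAlgebra.single 1 f

theorem shiftPow_mul_ofRat (k : ℤ) (f : RatFunc ℚ) :
    shiftPow k * ofRat f = ofRat (shift k f) * shiftPow k := by
  simp [shiftPow, ofRat, SkewMonoidAlgebra.single_mul_single, smul_def]

/-- `I = (1 / (2n)) (S⁻¹ - S)`, the operator of integration on Chebyshev coefficients. -/
def integrationOp : RecOp :=
  ofRat (1 / (2 * RatFunc.X)) * (shiftPow (-1) - shiftPow 1)

/-- `(1 / 2) (S + S⁻¹)`, the operator of multiplication by `x` on Chebyshev coefficients. -/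
def mulXOp : RecOp := ofRat (1 / 2) * (shiftPow 1 + shiftPow (-1))

/-- The evaluation `p((S + S⁻¹) / 2)` of a polynomial `p` with rational coefficients. -/
def evalMulX (p : ℚ[X]) : RecOp :=
  p.sum fun k c => ofRat (RatFunc.C c) * mulXOp ^ k

/-- `δ_r(n) = 2 ^ r ∏_{i = -r+1}^{r-1} (n - i)`. -/
def delta (r : ℕ) : RatFunc ℚ :=
  2 ^ r * ∏ i ∈ Finset.Icc (-(r : ℤ) + 1) ((r : ℤ) - 1), (RatFunc.X - (i : RatFunc ℚ))

/-- The coefficients `p_i` with `∑ j, a_j ∂ ^ j = ∑ i, ∂ ^ i p_i` (as differential operators), namely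
`p_i = ∑_{j ≥ i} (-1) ^ (j - i) (j choose i) a_j ^ (j - i)`, the last exponent being a derivative.
The summands with `j < i` vanish. -/
def rightCoeff {r : ℕ} (a : Fin (r + 1) → ℚ[X]) (i : Fin (r + 1)) : ℚ[X] :=
  ∑ j : Fin (r + 1),
    ((-1 : ℚ) ^ ((j : ℕ) - (i : ℕ)) * ((j : ℕ).choose i : ℚ)) •
      derivative^[(j : ℕ) - (i : ℕ)] (a j)

/-- The Chebyshev recurrence operator of `L = ∑ j, a_j ∂ ^ j = ∑ i, ∂ ^ i p_i` (of order `r`):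
`P = δ_r(n) I ^ r L = δ_r(n) ∑ i, I ^ (r - i) p_i((S + S⁻¹) / 2)`. -/
def chebyshevOp {r : ℕ} (a : Fin (r + 1) → ℚ[X]) : RecOp :=
  ofRat (delta r) *
    ∑ i : Fin (r + 1), integrationOp ^ (r - (i : ℕ)) * evalMulX (rightCoeff a i)

section NewtonPolygon

variable (P : RecOp)

/-- The coefficient `b_k` of `P = ∑ k, b_k(n) S ^ k`. -/
def opCoeff (k : ℤ) : RatFunc ℚ := SkewMonoidAlgebra.coeff P (Multiplicative.ofAdd k)

/-- The set of `k` with `b_k ≠ 0`. -/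
def opSupport : Finset ℤ := P.support.image Multiplicative.toAdd

/-- The half-order `s` of `P`: the largest `|k|` with `b_k ≠ 0`. -/
def halfOrder : ℕ := (opSupport P).sup Int.natAbs

/-- The ordinate `-deg b_k` of the point `p_k = (k, -deg b_k)`, defined for `b_k ≠ 0`. (The degree of
a rational function is the difference of the degrees of its numerator and denominator; it is the
usual degree when `b_k` is a polynomial.) -/
def height (k : ℤ) : ℤ := -(opCoeff P k).intDegree

/-- The leading coefficient of a rational function; the usual one for a polynomial. -/
def leadCoeff (f : RatFunc ℚ) : ℚ := f.num.leadingCoeff / f.denom.leadingCoeff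

/-- `p_k` is on the line through `p_i` and `p_j`. -/
def OnLine (i j k : ℤ) : Prop :=
  (j - i) * (height P k - height P i) = (height P j - height P i) * (k - i)

/-- `p_k` is strictly above the line through `p_i` and `p_j`, where `i < j`. -/
def AboveLine (i j k : ℤ) : Prop :=
  (height P j - height P i) * (k - i) < (j - i) * (height P k - height P i)

/-- `[p_i, p_j]` with `i < j` is an edge of the lower convex hull of the points `p_k`: all points are
on or above the line through `p_i` and `p_j`, and those on the line are in the segment. -/
def IsNewtonEdge (i j : ℤ) : Prop :=
  i ∈ opSupport P ∧ j ∈ opSupport P ∧ i < j ∧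
    ∀ k ∈ opSupport P, AboveLine P i j k ∨ (OnLine P i j k ∧ i ≤ k ∧ k ≤ j)

open Classical in
/-- The edges of the Newton polygon of `P`, as pairs `(i, j)` standing for `[p_i, p_j]`. -/
def newtonEdges : Finset (ℤ × ℤ) :=
  (opSupport P ×ˢ opSupport P).filter fun e => IsNewtonEdge P e.1 e.2

/-- The slope of the segment `[p_i, p_j]`. -/
def slope (e : ℤ × ℤ) : ℚ :=
  ((height P e.2 - height P e.1 : ℤ) : ℚ) / ((e.2 - e.1 : ℤ) : ℚ)

open Classical in
/-- The characteristic polynomial `∑_{k : p_k ∈ [p_i, p_j]} lc(b_k) α ^ (k - i)` of `[p_i, p_j]`. -/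
def charPoly (e : ℤ × ℤ) : ℚ[X] :=
  ∑ k ∈ (opSupport P).filter fun k => OnLine P e.1 e.2 k ∧ e.1 ≤ k ∧ k ≤ e.2,
    C (leadCoeff (opCoeff P k)) * X ^ (k - e.1).toNat

/-- All pairs `(κ, α)` where `κ` is the slope of an edge of the Newton polygon and `α` a complex root
of the characteristic polynomial of this edge, with multiplicities. -/
def newtonRoots : Multiset (ℚ × ℂ) :=
  ∑ e ∈ newtonEdges P, ((charPoly P e).aroots ℂ).map fun α => (slope P e, α)

/-- The indices `-s, …, -1, 1, …, s`. -/
def indexSet : Finset ℤ :=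
  (Finset.Icc (-(halfOrder P : ℤ)) (halfOrder P : ℤ)).erase 0

/-- `(κ_s, α_s), …, (κ_1, α_1), (κ_{-1}, α_{-1}), …, (κ_{-s}, α_{-s})` lists the roots of all
characteristic polynomials with the slopes of their edges, with multiplicities, edge after edge from
left to right (that is, by increasing slope), and by increasing modulus for each edge. -/
structure IsRootEnumeration (κ : ℤ → ℚ) (α : ℤ → ℂ) : Prop where
  roots : ((indexSet P).val.map fun i => (κ i, α i)) = newtonRoots P
  ordered : ∀ i ∈ indexSet P, ∀ j ∈ indexSet P, j < i →
    κ i < κ j ∨ (κ i = κ j ∧ ‖α i‖ ≤ ‖α j‖)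

end NewtonPolygon

end ChebyshevRecurrence

end

noncomputable section

namespace ChebyshevRecurrence

/-! The substitution `n ↦ -n`, `S ↦ S⁻¹` fixes `I` and `(S + S⁻¹) / 2` and changes `δ_r` at most by
a sign, so that `b_{-k}(n) = ± b_k(-n)` (`opCoeff_chebyshevOp_neg`). Hence the Newton polygon is
symmetric about the vertical axis. Along an edge of slope `κ` with left end `p_i`, the sign `(-1) ^
deg b_k` relating `lc b_{-k}` to `lc b_k` is a constant times `ζ ^ (k - i)`, where `ζ = exp(πκ√-1)`.
The roots on the mirror edge are therefore the numbers `ζ / ρ`, with `ρ` a root on the given edge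
and `‖ζ‖ = 1` (`aroots_charPoly_reflectEdge`).

A characteristic polynomial has the horizontal length of its edge as degree. These lengths add up to
the width of the polygon (`sum_isHullEdge`), which is `2s` by symmetry. The multiset of pairs `(κ,
|α|)` is invariant under `(κ, |α|) ↦ (-κ, |α|⁻¹)`, a map that reverses the lexicographic order, just
as `i ↦ -i` reverses the indices. Since a decreasing enumeration of a multiset is unique
(`eqOn_of_antitoneOn_of_map_eq`), every admissible enumeration is its own mirror image.

As for the horizontal edge, each factor `I` lowers degrees in `n` by at least one, so `b_k = δ_r
(u_k + o(1))` with `∑ u_k z ^ k = a_r((z + z⁻¹) / 2)` (`exists_opCoeff_chebyshevOp`). Up to a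
constant and a power of `z`, this Laurent polynomial is the characteristic polynomial of the edge.
On the unit circle `(z + z⁻¹) / 2 = Re z` lies in `[-1, 1]`, where `a_r` has no zero. -/

/-! ### Degrees and leading coefficients of rational functions -/

theorem intDegree_algebraMap_div {p q : ℚ[X]} (hp : p ≠ 0) (hq : q ≠ 0) :
    (algebraMap ℚ[X] (RatFunc ℚ) p / algebraMap ℚ[X] (RatFunc ℚ) q).intDegree =
      (p.natDegree : ℤ) - q.natDegree := by
  rw [RatFunc.intDegree_div (by simpa) (by simpa)]
  simp [RatFunc.intDegree_polynomial]

theorem leadCoeff_algebraMap_div (p : ℚ[X]) {q : ℚ[X]} (hq : q ≠ 0) :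
    leadCoeff (algebraMap ℚ[X] (RatFunc ℚ) p / algebraMap ℚ[X] (RatFunc ℚ) q) =
      p.leadingCoeff / q.leadingCoeff := by
  set f := algebraMap ℚ[X] (RatFunc ℚ) p / algebraMap ℚ[X] (RatFunc ℚ) q with hf
  have h := RatFunc.num_div_denom f
  rw [hf, div_eq_div_iff (by simpa using RatFunc.denom_ne_zero _) (by simpa), ← hf, ← map_mul,
    ← map_mul] at h
  have h' := congrArg leadingCoeff (RatFunc.algebraMap_injective ℚ h)
  rw [leadingCoeff_mul, leadingCoeff_mul] at h'
  rw [leadCoeff, div_eq_div_iff (by simpa using RatFunc.denom_ne_zero _) (by simpa), h']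

theorem leadCoeff_ne_zero {f : RatFunc ℚ} (hf : f ≠ 0) : leadCoeff f ≠ 0 :=
  div_ne_zero (by simpa using RatFunc.num_ne_zero hf) (by simpa using RatFunc.denom_ne_zero f)

theorem leadCoeff_mul (f g : RatFunc ℚ) : leadCoeff (f * g) = leadCoeff f * leadCoeff g := by
  conv_lhs => rw [← RatFunc.num_div_denom f, ← RatFunc.num_div_denom g, div_mul_div_comm,
    ← map_mul, ← map_mul]
  rw [leadCoeff_algebraMap_div _ (mul_ne_zero (RatFunc.denom_ne_zero f) (RatFunc.denom_ne_zero g)),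
    leadingCoeff_mul, leadingCoeff_mul, leadCoeff, leadCoeff, div_mul_div_comm]

theorem leadCoeff_C (c : ℚ) : leadCoeff (RatFunc.C c) = c := by
  rw [leadCoeff, RatFunc.num_C, RatFunc.denom_C, leadingCoeff_C, leadingCoeff_one, div_one]

/-- A nonzero limit at infinity is the leading coefficient. -/
theorem leadCoeff_eq_of_intDegree_sub_neg {f : RatFunc ℚ} {c : ℚ} (hc : c ≠ 0)
    (h : f = RatFunc.C c ∨ (f - RatFunc.C c).intDegree < 0) :
    f.intDegree = 0 ∧ leadCoeff f = c := by
  rcases h with rfl | h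
  · exact ⟨RatFunc.intDegree_C c, leadCoeff_C c⟩
  set g := f - RatFunc.C c with hg
  have hg0 : g ≠ 0 := by rintro h0; simp [h0] at h
  have hd := RatFunc.denom_ne_zero g
  have hdeg : g.num.degree < g.denom.degree := by
    rw [degree_eq_natDegree hd, degree_eq_natDegree (RatFunc.num_ne_zero hg0)]
    rw [RatFunc.intDegree] at h
    exact_mod_cast (by omega : g.num.natDegree < g.denom.natDegree)
  have hdeg' : g.num.degree < (C c * g.denom).degree := by
    rwa [degree_C_mul hc]
  -- Over the denominator of `g`, the numerator of `f` is dominated by `c` times that denominator.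
  have hf : f = algebraMap ℚ[X] (RatFunc ℚ) (g.num + C c * g.denom) /
      algebraMap ℚ[X] (RatFunc ℚ) g.denom := by
    rw [map_add, map_mul, add_div, RatFunc.num_div_denom, mul_div_assoc,
      div_self (by simpa using hd), mul_one, RatFunc.algebraMap_C, hg, sub_add_cancel]
  have hlc : (g.num + C c * g.denom).leadingCoeff = c * g.denom.leadingCoeff := by
    rw [leadingCoeff_add_of_degree_lt hdeg', leadingCoeff_mul, leadingCoeff_C]
  have hne : g.num + C c * g.denom ≠ 0 := by
    rw [← leadingCoeff_ne_zero, hlc]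
    exact mul_ne_zero hc (by simpa using hd)
  constructor
  · rw [hf, intDegree_algebraMap_div hne hd, natDegree_add_eq_right_of_degree_lt hdeg',
      natDegree_C_mul hc, sub_self]
  · rw [hf, leadCoeff_algebraMap_div _ hd, hlc, mul_div_assoc, div_self (by simpa using hd), mul_one]

/-- A substitution `n ↦ q(n)` with `q` of degree one preserves degrees and changes leading
coefficients by a power of that of `q`. -/
theorem intDegree_leadCoeff_of_comp (φ : RatFunc ℚ →+* RatFunc ℚ) {q : ℚ[X]}
    (hq : q.natDegree = 1)
    (h : ∀ p : ℚ[X], φ (algebraMap _ _ p) = algebraMap ℚ[X] (RatFunc ℚ) (p.comp q))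
    (f : RatFunc ℚ) :
    (φ f).intDegree = f.intDegree ∧
      leadCoeff (φ f) = leadCoeff f * q.leadingCoeff ^ f.intDegree := by
  rcases eq_or_ne f 0 with rfl | hf
  · simp [leadCoeff]
  have hlq : q.leadingCoeff ≠ 0 := by
    rw [leadingCoeff_ne_zero]; rintro rfl; simp at hq
  have hlc (p : ℚ[X]) : (p.comp q).leadingCoeff = p.leadingCoeff * q.leadingCoeff ^ p.natDegree :=
    leadingCoeff_comp (by omega)
  have hne {p : ℚ[X]} (hp : p ≠ 0) : p.comp q ≠ 0 := by
    rw [← leadingCoeff_ne_zero, hlc]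
    exact mul_ne_zero (by simpa) (pow_ne_zero _ hlq)
  have hφ : φ f = algebraMap ℚ[X] (RatFunc ℚ) (f.num.comp q) /
      algebraMap ℚ[X] (RatFunc ℚ) (f.denom.comp q) := by
    conv_lhs => rw [← RatFunc.num_div_denom f, map_div₀, h, h]
  have hn := RatFunc.num_ne_zero hf
  have hd := RatFunc.denom_ne_zero f
  constructor
  · rw [hφ, intDegree_algebraMap_div (hne hn) (hne hd), natDegree_comp, natDegree_comp, hq,
      mul_one, mul_one, RatFunc.intDegree]
  · rw [hφ, leadCoeff_algebraMap_div _ (hne hd), hlc, hlc, RatFunc.intDegree, leadCoeff,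
      zpow_sub₀ hlq, zpow_natCast, zpow_natCast, div_mul_div_comm]

theorem intDegree_shift (k : ℤ) (f : RatFunc ℚ) : (shift k f).intDegree = f.intDegree :=
  (intDegree_leadCoeff_of_comp (shift k) (natDegree_X_add_C _) (shift_algebraMap k) f).1

/-! ### The reflection `n ↦ -n` -/

/-- The automorphism `f(n) ↦ f(-n)` of `ℚ(n)`. -/
def reflect : RatFunc ℚ →+* RatFunc ℚ :=
  RatFunc.mapRingHom (compRingHom (-X : ℚ[X]))
    (nonZeroDivisors_le_comap_nonZeroDivisors_of_injective _ fun p q h => by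
      have := congrArg (fun p => p.comp (-X)) h
      simpa [comp_assoc] using this)

theorem reflect_algebraMap (p : ℚ[X]) :
    reflect (algebraMap ℚ[X] (RatFunc ℚ) p) = algebraMap ℚ[X] (RatFunc ℚ) (p.comp (-X)) := by
  have h := RatFunc.map_apply_div (compRingHom (-X : ℚ[X]))
    (nonZeroDivisors_le_comap_nonZeroDivisors_of_injective _ fun p q h => by
      have := congrArg (fun p => p.comp (-X)) h
      simpa [comp_assoc] using this) p 1
  simp only [map_one, div_one] at h
  rw [reflect, RatFunc.coe_mapRingHom_eq_coe_map, h]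
  rfl

theorem reflect_X : reflect RatFunc.X = -RatFunc.X := by
  rw [← RatFunc.algebraMap_X, reflect_algebraMap]; simp

theorem reflect_C (c : ℚ) : reflect (RatFunc.C c) = RatFunc.C c := by
  rw [← RatFunc.algebraMap_C, reflect_algebraMap]; simp

theorem shift_C (k : ℤ) (c : ℚ) : shift k (RatFunc.C c) = RatFunc.C c := by
  rw [← RatFunc.algebraMap_C, shift_algebraMap]; simp

theorem reflect_shift (k : ℤ) (f : RatFunc ℚ) : reflect (shift k f) = shift (-k) (reflect f) := by
  have : reflect.comp (shift k) = (shift (-k)).comp reflect :=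
    ringHom_ratFunc_ext fun p => by
      simp [shift_algebraMap, reflect_algebraMap, comp_assoc, add_comm]
  exact DFunLike.congr_fun this f

theorem intDegree_reflect (f : RatFunc ℚ) : (reflect f).intDegree = f.intDegree :=
  (intDegree_leadCoeff_of_comp reflect (by simp) reflect_algebraMap f).1

theorem leadCoeff_reflect (f : RatFunc ℚ) :
    leadCoeff (reflect f) = leadCoeff f * (-1) ^ f.intDegree := by
  simpa using (intDegree_leadCoeff_of_comp reflect (by simp) reflect_algebraMap f).2

theorem delta_ne_zero (r : ℕ) : delta r ≠ 0 := by
  refine mul_ne_zero (pow_ne_zero _ two_ne_zero) (Finset.prod_ne_zero_iff.2 fun i _ h => ?_)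
  have h' := congrArg RatFunc.intDegree (sub_eq_zero.1 h)
  rw [RatFunc.intDegree_X, show (i : RatFunc ℚ) = RatFunc.C (i : ℚ) by simp,
    RatFunc.intDegree_C] at h'
  exact one_ne_zero h'

/-- The zeros of `δ_r` are symmetric about `0`, so its linear factors are permuted up to one sign
each. The parity of their number plays no role later. -/
theorem reflect_delta (r : ℕ) : reflect (delta r) = delta r ∨ reflect (delta r) = -delta r := by
  have h : reflect (delta r) =
      (-1) ^ (Finset.Icc (-(r : ℤ) + 1) ((r : ℤ) - 1)).card * delta r := by
    rw [delta, map_mul, map_prod, map_pow, map_ofNat, mul_left_comm, ← Finset.prod_const,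
      ← Finset.prod_mul_distrib]
    congr 1
    refine Finset.prod_nbij' (fun i => -i) (fun i => -i) ?_ ?_ ?_ ?_ ?_ <;>
      simp +contextual only [Finset.mem_Icc, neg_neg, implies_true]
    · omega
    · omega
    · intro i _
      simp [reflect_X]
      ring
  rcases neg_one_pow_eq_or (RatFunc ℚ) (Finset.Icc (-(r : ℤ) + 1) ((r : ℤ) - 1)).card with h' | h' <;>
    rw [h, h'] <;> simp

/-! ### Coefficients of operators and their symmetry -/

theorem opCoeff_add (P Q : RecOp) (k : ℤ) : opCoeff (P + Q) k = opCoeff P k + opCoeff Q k := by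
  simp [opCoeff, SkewMonoidAlgebra.coeff_add]

theorem opCoeff_sub (P Q : RecOp) (k : ℤ) : opCoeff (P - Q) k = opCoeff P k - opCoeff Q k := by
  simp [opCoeff, SkewMonoidAlgebra.coeff_sub]

theorem opCoeff_zero (k : ℤ) : opCoeff 0 k = 0 := by
  simp [opCoeff]

theorem opCoeff_sum {ι : Type*} (s : Finset ι) (P : ι → RecOp) (k : ℤ) :
    opCoeff (∑ i ∈ s, P i) k = ∑ i ∈ s, opCoeff (P i) k :=
  map_sum (⟨⟨fun P => opCoeff P k, opCoeff_zero k⟩, fun P Q => opCoeff_add P Q k⟩ : RecOp →+ _) P s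

theorem opCoeff_ofRat_mul (f : RatFunc ℚ) (P : RecOp) (k : ℤ) :
    opCoeff (ofRat f * P) k = f * opCoeff P k :=
  SkewMonoidAlgebra.coeff_single_one_mul _ _ _

theorem opCoeff_shiftPow_mul (j : ℤ) (P : RecOp) (k : ℤ) :
    opCoeff (shiftPow j * P) k = shift j (opCoeff P (k - j)) := by
  simp only [opCoeff, shiftPow, SkewMonoidAlgebra.coeff_single_mul, one_mul, smul_def,
    toAdd_ofAdd]
  congr 2
  rw [sub_eq_neg_add, ofAdd_add, ofAdd_neg]

theorem opCoeff_integrationOp_mul (P : RecOp) (k : ℤ) :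
    opCoeff (integrationOp * P) k =
      1 / (2 * RatFunc.X) * (shift (-1) (opCoeff P (k + 1)) - shift 1 (opCoeff P (k - 1))) := by
  rw [integrationOp, mul_assoc, opCoeff_ofRat_mul, sub_mul, opCoeff_sub, opCoeff_shiftPow_mul,
    opCoeff_shiftPow_mul, sub_neg_eq_add]

theorem opCoeff_mulXOp_mul (P : RecOp) (k : ℤ) :
    opCoeff (mulXOp * P) k =
      1 / 2 * (shift 1 (opCoeff P (k - 1)) + shift (-1) (opCoeff P (k + 1))) := by
  rw [mulXOp, mul_assoc, opCoeff_ofRat_mul, add_mul, opCoeff_add, opCoeff_shiftPow_mul,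
    opCoeff_shiftPow_mul, sub_neg_eq_add]

theorem opCoeff_one (k : ℤ) : opCoeff 1 k = if k = 0 then 1 else 0 := by
  rw [opCoeff, SkewMonoidAlgebra.coeff_one, Finsupp.single_apply]
  simp only [eq_comm (a := (1 : Multiplicative ℤ)), ofAdd_eq_one]

theorem mem_opSupport {P : RecOp} {k : ℤ} : k ∈ opSupport P ↔ opCoeff P k ≠ 0 := by
  simp only [opSupport, Finset.mem_image, SkewMonoidAlgebra.mem_support_iff, opCoeff]
  exact ⟨by rintro ⟨a, h, rfl⟩; exact h, fun h => ⟨_, h, rfl⟩⟩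

/-- The coefficients of a polynomial in the operator `(S + S⁻¹) / 2` are constants, and those of the
corresponding Laurent polynomial. -/
theorem exists_opCoeff_evalMulX (p : ℚ[X]) :
    ∃ u : ℤ →₀ ℚ, (∀ k, opCoeff (evalMulX p) k = RatFunc.C (u k)) ∧ (∀ k, u (-k) = u k) ∧
      ∀ z : ℂ, z ≠ 0 → (u.sum fun k c => (c : ℂ) * z ^ k) = aeval ((z + z⁻¹) / 2) p := by
  have hpow (m : ℕ) : ∃ u : ℤ →₀ ℚ,
      (∀ k, opCoeff (mulXOp ^ m) k = RatFunc.C (u k)) ∧ (∀ k, u (-k) = u k) ∧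
        ∀ z : ℂ, z ≠ 0 → (u.sum fun k c => (c : ℂ) * z ^ k) = ((z + z⁻¹) / 2) ^ m := by
    induction m with
    | zero =>
      refine ⟨Finsupp.single 0 1, fun k => ?_, fun k => ?_, fun z _ => ?_⟩
      · rw [pow_zero, opCoeff_one, Finsupp.single_apply]
        split_ifs <;> first | omega | simp
      · simp [Finsupp.single_apply, eq_comm]
      · simp
    | succ m ih =>
      obtain ⟨u, hu, hs, hz⟩ := ih
      -- `v d` is the coefficient family of `z ^ d` times the Laurent polynomial of `u`.
      let v (d : ℤ) : ℤ →₀ ℚ := u.embDomain (Equiv.addRight d).toEmbedding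
      have hv (d k : ℤ) : v d k = u (k - d) := by
        simpa [v] using Finsupp.embDomain_apply_self (Equiv.addRight d).toEmbedding u (k - d)
      refine ⟨(1 / 2 : ℚ) • (v 1 + v (-1)), fun k => ?_, fun k => ?_, fun z hz0 => ?_⟩
      · rw [pow_succ', opCoeff_mulXOp_mul, hu, hu, shift_C, shift_C, ← map_add]
        simp only [Finsupp.smul_apply, Finsupp.add_apply, hv, smul_eq_mul, map_mul, sub_neg_eq_add]
        simp
      · simp only [Finsupp.smul_apply, Finsupp.add_apply, hv]
        rw [← hs (-k - 1), ← hs (-k - -1), add_comm]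
        ring_nf
      · have hw (d : ℤ) : ((v d).sum fun k c => (c : ℂ) * z ^ k) =
            z ^ d * ((z + z⁻¹) / 2) ^ m := by
          rw [Finsupp.sum_embDomain, ← hz z hz0, Finsupp.mul_sum]
          refine Finsupp.sum_congr fun k _ => ?_
          simp [zpow_add₀ hz0]
          ring
        rw [Finsupp.sum_smul_index (by simp)]
        simp only [Rat.cast_mul, mul_assoc]
        rw [← Finsupp.mul_sum, Finsupp.sum_add_index' (by simp) (by intros; push_cast; ring), hw, hw,
          pow_succ]
        simp
        ring
  choose w hw hs hz using hpow
  refine ⟨∑ m ∈ p.support, p.coeff m • w m, fun k => ?_, fun k => ?_, fun z hz0 => ?_⟩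
  · rw [evalMulX, Polynomial.sum, opCoeff_sum, Finsupp.finsetSum_apply, map_sum]
    refine Finset.sum_congr rfl fun m _ => ?_
    rw [opCoeff_ofRat_mul, hw, Finsupp.smul_apply, smul_eq_mul, map_mul]
  · simp [Finsupp.finsetSum_apply, hs]
  · rw [← Finsupp.sum_finsetSum_index (by simp) (by intros; push_cast; ring),
      aeval_eq_sum_range, Finset.sum_subset Polynomial.supp_subset_range_natDegree_succ]
    · refine Finset.sum_congr rfl fun m _ => ?_
      rw [Finsupp.sum_smul_index (by simp), ← hz m z hz0, Algebra.smul_def, Finsupp.mul_sum]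
      refine Finsupp.sum_congr fun k _ => ?_
      simp [mul_assoc]
    · intro m _ hm
      simp [Polynomial.notMem_support_iff.1 hm]

/-- `I ^ m Q` is invariant under `S ↦ S⁻¹`, `n ↦ -n` if `Q` is. -/
theorem opCoeff_neg_integrationOp_pow_mul {Q : RecOp}
    (hQ : ∀ k, opCoeff Q (-k) = reflect (opCoeff Q k)) (m : ℕ) (k : ℤ) :
    opCoeff (integrationOp ^ m * Q) (-k) = reflect (opCoeff (integrationOp ^ m * Q) k) := by
  induction m generalizing k with
  | zero => simpa using hQ k
  | succ m ih =>
    rw [pow_succ', mul_assoc, opCoeff_integrationOp_mul, opCoeff_integrationOp_mul,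
      show -k + 1 = -(k - 1) by ring, show -k - 1 = -(k + 1) by ring, ih, ih]
    simp only [map_mul, map_sub, map_div₀, map_one, reflect_X, reflect_shift, map_ofNat, neg_neg]
    rw [mul_neg, div_neg, neg_mul, ← mul_neg, neg_sub]

theorem opCoeff_neg_evalMulX (p : ℚ[X]) (k : ℤ) :
    opCoeff (evalMulX p) (-k) = reflect (opCoeff (evalMulX p) k) := by
  obtain ⟨u, hu, hs, -⟩ := exists_opCoeff_evalMulX p
  rw [hu, hu, hs, reflect_C]

/-- The symmetry `b_{-k}(n) = ± b_k(-n)` of the Chebyshev recurrence operator. -/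
theorem opCoeff_chebyshevOp_neg {r : ℕ} (a : Fin (r + 1) → ℚ[X]) :
    ∃ ε : ℚ, (ε = 1 ∨ ε = -1) ∧ ∀ k, opCoeff (chebyshevOp a) (-k) =
      RatFunc.C ε * reflect (opCoeff (chebyshevOp a) k) := by
  have h (k : ℤ) : opCoeff (∑ i : Fin (r + 1),
        integrationOp ^ (r - (i : ℕ)) * evalMulX (rightCoeff a i)) (-k) =
      reflect (opCoeff (∑ i : Fin (r + 1),
        integrationOp ^ (r - (i : ℕ)) * evalMulX (rightCoeff a i)) k) := by
    rw [opCoeff_sum, opCoeff_sum, map_sum]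
    exact Finset.sum_congr rfl fun i _ =>
      opCoeff_neg_integrationOp_pow_mul (opCoeff_neg_evalMulX _) _ _
  rcases reflect_delta r with hd | hd
  · refine ⟨1, Or.inl rfl, fun k => ?_⟩
    rw [chebyshevOp, opCoeff_ofRat_mul, opCoeff_ofRat_mul, h, map_mul, hd, map_one, one_mul]
  · refine ⟨-1, Or.inr rfl, fun k => ?_⟩
    rw [chebyshevOp, opCoeff_ofRat_mul, opCoeff_ofRat_mul, h, map_mul, hd, map_neg, map_one]
    ring

/-! ### Behaviour of the coefficients as `n → ∞` -/

open Classical in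
theorem inftyValuation_shift (k : ℤ) (f : RatFunc ℚ) :
    RatFunc.inftyValuation ℚ (shift k f) = RatFunc.inftyValuation ℚ f := by
  rcases eq_or_ne f 0 with rfl | hf
  · simp
  · rw [RatFunc.inftyValuation_apply, RatFunc.inftyValuation_apply,
      RatFunc.inftyValuation_of_nonzero ℚ hf,
      RatFunc.inftyValuation_of_nonzero ℚ ((_root_.map_ne_zero _).2 hf), intDegree_shift]

-- Shifts preserve the valuation at infinity, and the factor `1 / (2n)` makes it drop. The
-- valuation, unlike `intDegree`, also treats vanishing coefficients uniformly.
open Classical in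
theorem inftyValuation_opCoeff_integrationOp_mul_lt {Q : RecOp}
    (hQ : ∀ k, RatFunc.inftyValuation ℚ (opCoeff Q k) ≤ 1) (k : ℤ) :
    RatFunc.inftyValuation ℚ (opCoeff (integrationOp * Q) k) < 1 := by
  have h2 : RatFunc.inftyValuation ℚ (1 / (2 * RatFunc.X)) < 1 := by
    have : (2 : RatFunc ℚ) = RatFunc.C 2 := by simp
    rw [map_div₀, map_one, map_mul, this, RatFunc.inftyValuation.C ℚ two_ne_zero,
      RatFunc.inftyValuation.X, one_mul, one_div, ← WithZero.exp_neg, ← WithZero.exp_zero,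
      WithZero.exp_lt_exp]
    norm_num
  rw [opCoeff_integrationOp_mul, map_mul]
  refine mul_lt_one_of_lt_of_le h2 ((Valuation.map_sub _ _ _).trans (max_le ?_ ?_)) <;>
    rw [inftyValuation_shift] <;> exact hQ _

open Classical in
theorem inftyValuation_opCoeff_integrationOp_pow_mul_lt {Q : RecOp}
    (hQ : ∀ k, RatFunc.inftyValuation ℚ (opCoeff Q k) ≤ 1) {m : ℕ} (hm : m ≠ 0) (k : ℤ) :
    RatFunc.inftyValuation ℚ (opCoeff (integrationOp ^ m * Q) k) < 1 := by
  obtain ⟨m, rfl⟩ := Nat.exists_eq_succ_of_ne_zero hm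
  rw [pow_succ', mul_assoc]
  refine inftyValuation_opCoeff_integrationOp_mul_lt (fun k => ?_) k
  clear hm
  induction m generalizing k with
  | zero => simpa using hQ k
  | succ m ih =>
    rw [pow_succ', mul_assoc]
    exact (inftyValuation_opCoeff_integrationOp_mul_lt ih k).le

/-- Moving `∂` to the left of a coefficient only creates terms of lower order. -/
theorem rightCoeff_last {r : ℕ} (a : Fin (r + 1) → ℚ[X]) :
    rightCoeff a (Fin.last r) = a (Fin.last r) := by
  rw [rightCoeff, Finset.sum_eq_single (Fin.last r)]
  · simp
  · intro j _ hj
    have : (j : ℕ) < r := Fin.val_lt_last hj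
    rw [Fin.val_last, Nat.choose_eq_zero_of_lt this]
    simp
  · simp

/-- After division by `δ_r`, the coefficients of the Chebyshev recurrence operator tend to those of
`a_r((z + z⁻¹) / 2)` at infinity. -/
theorem exists_opCoeff_chebyshevOp {r : ℕ} (a : Fin (r + 1) → ℚ[X]) :
    ∃ u : ℤ →₀ ℚ,
      (∀ z : ℂ, z ≠ 0 →
        (u.sum fun k c => (c : ℂ) * z ^ k) = aeval ((z + z⁻¹) / 2) (a (Fin.last r))) ∧
      ∀ k, ∃ g : RatFunc ℚ, opCoeff (chebyshevOp a) k = delta r * (RatFunc.C (u k) + g) ∧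
        (g = 0 ∨ g.intDegree < 0) := by
  classical
  obtain ⟨u, hu, -, hz⟩ := exists_opCoeff_evalMulX (rightCoeff a (Fin.last r))
  rw [rightCoeff_last] at hz
  refine ⟨u, hz, fun k => ⟨∑ i : Fin r, opCoeff (integrationOp ^ (r - (i : ℕ)) *
    evalMulX (rightCoeff a i.castSucc)) k, ?_, ?_⟩⟩
  · rw [chebyshevOp, opCoeff_ofRat_mul, opCoeff_sum, Fin.sum_univ_castSucc]
    simp only [Fin.val_last, Nat.sub_self, pow_zero, one_mul, hu, Fin.val_castSucc]
    rw [add_comm]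
  · set g := ∑ i : Fin r, opCoeff (integrationOp ^ (r - (i : ℕ)) *
      evalMulX (rightCoeff a i.castSucc)) k with hg
    -- Every summand has `i < r`, hence at least one factor `I`.
    have hv : RatFunc.inftyValuation ℚ g < 1 := by
      refine Valuation.map_sum_lt _ one_ne_zero fun i _ => ?_
      refine inftyValuation_opCoeff_integrationOp_pow_mul_lt (fun j => ?_) (by omega) k
      obtain ⟨w, hw, -⟩ := exists_opCoeff_evalMulX (rightCoeff a i.castSucc)
      rw [hw]
      rcases eq_or_ne (w j) 0 with h0 | h0
      · simp [h0]
      · exact (RatFunc.inftyValuation.C ℚ h0).le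
    refine or_iff_not_imp_left.2 fun h0 => ?_
    rw [RatFunc.inftyValuation_apply, RatFunc.inftyValuation_of_nonzero ℚ h0, ← WithZero.exp_zero,
      WithZero.exp_lt_exp] at hv
    exact hv

/-! ### Lower convex hulls of finitely many points -/

/-- `[(i, h i), (j, h j)]` is an edge of slope `κ` of the lower convex hull of the points `(k, h k)`,
`k ∈ T`. -/
def IsHullEdge (T : Finset ℤ) (h : ℤ → ℤ) (κ : ℚ) (i j : ℤ) : Prop :=
  i ∈ T ∧ j ∈ T ∧ i < j ∧ (h j : ℚ) = h i + κ * (j - i) ∧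
    ∀ k ∈ T, (h i : ℚ) + κ * (k - i) ≤ h k ∧
      ((h k : ℚ) = h i + κ * (k - i) → i ≤ k ∧ k ≤ j)

/-- There is an edge at the leftmost point. -/
theorem exists_isHullEdge_of_forall_le {T : Finset ℤ} {m M : ℤ} (h : ℤ → ℤ) (hm : m ∈ T)
    (hM : M ∈ T) (hmM : m < M) (hT : ∀ k ∈ T, m ≤ k) : ∃ κ j, IsHullEdge T h κ m j := by
  -- `f k` is the slope from `m` to `k`. The edge has minimal slope and ends at the last point
  -- attaining it.
  let f (k : ℤ) : ℚ := ((h k : ℚ) - h m) / (k - m)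
  obtain ⟨j₀, hj₀, hmin⟩ := (T.filter (m < ·)).exists_min_image f ⟨M, by simp [hM, hmM]⟩
  obtain ⟨j, hj, hmax⟩ := ((T.filter (m < ·)).filter (f · = f j₀)).exists_max_image id
    ⟨j₀, by simpa using hj₀⟩
  simp only [Finset.mem_filter, id, and_imp] at hj hmax hmin
  obtain ⟨⟨hjT, hmj⟩, hfj⟩ := hj
  have hf {k : ℤ} (hk : m < k) : (h k : ℚ) = h m + f k * (k - m) := by
    have : (k : ℚ) - m ≠ 0 := by rw [sub_ne_zero]; exact_mod_cast hk.ne'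
    simp only [f]; field_simp; ring
  refine ⟨f j₀, j, hm, hjT, hmj, by rw [hf hmj, hfj], fun k hk => ?_⟩
  rcases (hT k hk).eq_or_lt with rfl | hmk
  · simp [hmj.le]
  have hpos : (0 : ℚ) < k - m := by rw [sub_pos]; exact_mod_cast hmk
  refine ⟨?_, fun heq => ⟨hmk.le, hmax k hk hmk ?_⟩⟩
  · rw [hf hmk]
    have := hmin k hk hmk
    gcongr
  · rw [hf hmk, add_right_inj] at heq
    exact mul_right_cancel₀ hpos.ne' heq

/-- The steeper of two edges with a common left end would pass above the right end of the other. So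
the slopes agree, and each right end bounds the other. -/
theorem IsHullEdge.right_unique {T : Finset ℤ} {h : ℤ → ℤ} {κ κ' : ℚ} {i j j' : ℤ}
    (e : IsHullEdge T h κ i j) (e' : IsHullEdge T h κ' i j') : j = j' := by
  wlog hκ : κ ≤ κ' generalizing κ κ' j j'
  · exact (this e' e (le_of_not_ge hκ)).symm
  obtain ⟨-, hj, hij, hs, hl⟩ := e
  obtain ⟨-, hj', hij', hs', hl'⟩ := e'
  have h1 := (hl' j hj).1
  have hpos : (0 : ℚ) < j - i := by rw [sub_pos]; exact_mod_cast hij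
  have : κ = κ' := by
    refine le_antisymm hκ (le_of_mul_le_mul_right ?_ hpos)
    linarith
  subst this
  have h2 := ((hl' j hj).2 hs).2
  have h3 := ((hl j' hj').2 hs').2
  omega

/-- The edges of the hull of `T` are the one at the leftmost point and those of the hull of the
points on its right. -/
theorem IsHullEdge.isHullEdge_iff {T : Finset ℤ} {h : ℤ → ℤ} {κ : ℚ} {m j : ℤ}
    (e : IsHullEdge T h κ m j) (hT : ∀ k ∈ T, m ≤ k) (i' j' : ℤ) :
    (∃ κ', IsHullEdge T h κ' i' j') ↔
      (i' = m ∧ j' = j) ∨ ∃ κ', IsHullEdge (T.filter (j ≤ ·)) h κ' i' j' := by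
  obtain ⟨hm, hj, hmj, hs, hl⟩ := id e
  have hmjQ : (m : ℚ) < j := by exact_mod_cast hmj
  constructor
  · rintro ⟨κ', e'⟩
    obtain ⟨hi', hj', hij', hs', hl'⟩ := id e'
    have hijQ : (i' : ℚ) < j' := by exact_mod_cast hij'
    rcases (hT i' hi').eq_or_lt with rfl | hmi'
    · exact Or.inl ⟨rfl, (e.right_unique e').symm⟩
    refine Or.inr ⟨κ', ?_⟩
    -- If `m < i' < j`, then `m` is strictly above the line of the edge at `i'`, which forces `κ <
    -- κ'`. As `i'` is not below the first edge, its line would then pass above the point at `j`.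
    have hji : j ≤ i' := by
      by_contra! hlt
      have hltQ : (i' : ℚ) < j := by exact_mod_cast hlt
      have hmiQ : (m : ℚ) < i' := by exact_mod_cast hmi'
      have h1 : (h i' : ℚ) + κ' * (m - i') < h m :=
        lt_of_le_of_ne (hl' m hm).1 fun heq => by
          have := ((hl' m hm).2 heq.symm).1
          omega
      have h2 := (hl i' hi').1
      have h3 := (hl' j hj).1
      have hκ : κ < κ' := by
        refine lt_of_mul_lt_mul_right (a := (i' - m : ℚ)) ?_ (by linarith)
        linarith
      have := mul_lt_mul_of_pos_right hκ (sub_pos.2 hltQ)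
      linarith
    refine ⟨by simp [hi', hji], by simp [hj']; omega, hij', hs', fun k hk => ?_⟩
    exact hl' k (Finset.mem_filter.1 hk).1
  · rintro (⟨rfl, rfl⟩ | ⟨κ', hi', hj', hij', hs', hl'⟩)
    · exact ⟨κ, e⟩
    rw [Finset.mem_filter] at hi' hj'
    have hijQ : (i' : ℚ) < j' := by exact_mod_cast hij'
    have hjiQ : (j : ℚ) ≤ i' := by exact_mod_cast hi'.2
    -- Conversely, `j'` is strictly above the line of the first edge, so `κ < κ'`. The points left
    -- of `j` are on or above that line, which there lies strictly above the line of slope `κ'`.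
    have h1 : (h m : ℚ) + κ * (j' - m) < h j' :=
      lt_of_le_of_ne (hl j' hj'.1).1 fun heq => by
        have := ((hl j' hj'.1).2 heq.symm).2
        omega
    have h2 := (hl' j (by simp [hj])).1
    have h3 := (hl i' hi'.1).1
    have hκ : κ < κ' := by
      refine lt_of_mul_lt_mul_right (a := (j' - j : ℚ)) ?_ (by linarith)
      linarith
    refine ⟨κ', hi'.1, hj'.1, hij', hs', fun k hk => ?_⟩
    rcases le_or_gt j k with hjk | hkj
    · exact hl' k (by simp [hk, hjk])
    · have hkjQ : (k : ℚ) < j := by exact_mod_cast hkj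
      have h4 := (hl k hk).1
      have h5 := mul_lt_mul_of_pos_right hκ (sub_pos.2 hkjQ)
      have h6 : (h i' : ℚ) + κ' * (k - i') < h k := by linarith
      exact ⟨h6.le, fun heq => absurd heq h6.ne'⟩

open Classical in
/-- The horizontal lengths of the edges of the lower convex hull add up to the width. -/
theorem sum_isHullEdge (h : ℤ → ℤ) (T : Finset ℤ) :
    ∀ m ∈ T, ∀ M ∈ T, (∀ k ∈ T, m ≤ k ∧ k ≤ M) →
      ∑ e ∈ (T ×ˢ T).filter (fun e => ∃ κ, IsHullEdge T h κ e.1 e.2), (e.2 - e.1) = M - m := by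
  induction T using Finset.strongInduction with
  | H T ih =>
  intro m hm M hM hT
  rcases (hT m hm).2.eq_or_lt with rfl | hmM
  · rw [Finset.sum_eq_zero, sub_self]
    intro e he
    obtain ⟨κ, h1, h2, h3, -⟩ := (Finset.mem_filter.1 he).2
    have := hT _ h1
    have := hT _ h2
    omega
  obtain ⟨κ, j, e⟩ := exists_isHullEdge_of_forall_le h hm hM hmM fun k hk => (hT k hk).1
  obtain ⟨-, hj, hmj, -⟩ := id e
  have hset : (T ×ˢ T).filter (fun e => ∃ κ, IsHullEdge T h κ e.1 e.2) =
      insert (m, j) (((T.filter (j ≤ ·)) ×ˢ (T.filter (j ≤ ·))).filter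
        (fun e => ∃ κ, IsHullEdge (T.filter (j ≤ ·)) h κ e.1 e.2)) := by
    ext ⟨i', j'⟩
    have hiff := e.isHullEdge_iff (fun k hk => (hT k hk).1) i' j'
    simp only [Finset.mem_filter, Finset.mem_product, Finset.mem_insert, Prod.mk.injEq]
    rw [hiff]
    constructor
    · rintro ⟨-, h' | ⟨κ', h'⟩⟩
      · exact Or.inl h'
      · exact Or.inr ⟨⟨Finset.mem_filter.1 h'.1, Finset.mem_filter.1 h'.2.1⟩, κ', h'⟩
    · rintro (⟨rfl, rfl⟩ | ⟨h1, h'⟩)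
      · exact ⟨⟨hm, hj⟩, Or.inl ⟨rfl, rfl⟩⟩
      · exact ⟨⟨h1.1.1, h1.2.1⟩, Or.inr h'⟩
  have hlt : T.filter (j ≤ ·) ⊂ T :=
    Finset.filter_ssubset.2 ⟨m, hm, by omega⟩
  rw [hset, Finset.sum_insert, ih _ hlt j (by simp [hj]) M (by simp [hM, (hT j hj).2])]
  · ring
  · intro k hk
    rw [Finset.mem_filter] at hk
    exact ⟨hk.2, (hT k hk.1).2⟩
  · simp only [Finset.mem_filter, Finset.mem_product, not_and]
    omega

/-! ### Edges and characteristic polynomials of the Newton polygon -/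

section

variable (P : RecOp)

theorem onLine_iff {i j : ℤ} (hij : i < j) (k : ℤ) :
    OnLine P i j k ↔ (height P k : ℚ) = height P i + slope P (i, j) * (k - i) := by
  have hpos : (0 : ℚ) < j - i := by rw [sub_pos]; exact_mod_cast hij
  rw [OnLine, slope, ← @Int.cast_inj ℚ]
  push_cast
  rw [← sub_eq_iff_eq_add', div_mul_eq_mul_div, eq_div_iff hpos.ne', mul_comm]

theorem aboveLine_iff {i j : ℤ} (hij : i < j) (k : ℤ) :
    AboveLine P i j k ↔ height P i + slope P (i, j) * (k - i) < (height P k : ℚ) := by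
  have hpos : (0 : ℚ) < j - i := by rw [sub_pos]; exact_mod_cast hij
  rw [AboveLine, slope, ← @Int.cast_lt ℚ]
  push_cast
  rw [← lt_sub_iff_add_lt', div_mul_eq_mul_div, div_lt_iff₀ hpos, mul_comm ((j : ℚ) - i)]

theorem isNewtonEdge_iff (i j : ℤ) :
    IsNewtonEdge P i j ↔ IsHullEdge (opSupport P) (height P) (slope P (i, j)) i j := by
  refine and_congr_right fun hi => and_congr_right fun hj => and_congr_right fun hij => ?_
  have h1 : (height P j : ℚ) = height P i + slope P (i, j) * (j - i) :=
    (onLine_iff P hij j).1 (mul_comm _ _)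
  rw [and_iff_right h1]
  refine forall₂_congr fun k _ => ?_
  rw [onLine_iff P hij, aboveLine_iff P hij]
  constructor
  · rintro (h | h)
    · exact ⟨h.le, fun h' => absurd h' h.ne'⟩
    · exact ⟨h.1.ge, fun _ => h.2⟩
  · rintro ⟨h, h'⟩
    exact h.lt_or_eq.imp_right fun h => ⟨h.symm, h' h.symm⟩

theorem isNewtonEdge_iff_exists (i j : ℤ) :
    IsNewtonEdge P i j ↔ ∃ κ, IsHullEdge (opSupport P) (height P) κ i j := by
  rw [isNewtonEdge_iff]
  refine ⟨fun h => ⟨_, h⟩, fun ⟨κ, h⟩ => ?_⟩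
  have hij : i < j := h.2.2.1
  have hpos : (0 : ℚ) < j - i := by rw [sub_pos]; exact_mod_cast hij
  have : slope P (i, j) = κ := by
    rw [slope]
    push_cast
    rw [div_eq_iff hpos.ne', h.2.2.2.1]
    ring
  rwa [this]

theorem sum_newtonEdges {m M : ℤ} (hm : m ∈ opSupport P) (hM : M ∈ opSupport P)
    (h : ∀ k ∈ opSupport P, m ≤ k ∧ k ≤ M) : ∑ e ∈ newtonEdges P, (e.2 - e.1) = M - m := by
  classical
  rw [← sum_isHullEdge (height P) (opSupport P) m hm M hM h, newtonEdges]
  simp only [isNewtonEdge_iff_exists]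

variable {P}

theorem mem_newtonEdges {e : ℤ × ℤ} : e ∈ newtonEdges P ↔ IsNewtonEdge P e.1 e.2 := by
  classical
  rw [newtonEdges, Finset.mem_filter, Finset.mem_product]
  exact ⟨fun h => h.2, fun h => ⟨⟨h.1, h.2.1⟩, h⟩⟩

-- Distinct `k` contribute distinct exponents, so nothing cancels. The extreme coefficients come
-- from the two ends of the edge, where `b_k ≠ 0`.
open Classical in
theorem natDegree_charPoly_and_coeff_zero {e : ℤ × ℤ} (he : e ∈ newtonEdges P) :
    ((charPoly P e).natDegree : ℤ) = e.2 - e.1 ∧ (charPoly P e).coeff 0 ≠ 0 := by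
  obtain ⟨hi, hj, hij, -⟩ := mem_newtonEdges.1 he
  have hcoeff {k : ℤ} (hk : k ∈ (opSupport P).filter fun k => OnLine P e.1 e.2 k ∧ e.1 ≤ k ∧ k ≤ e.2) :
      (charPoly P e).coeff (k - e.1).toNat ≠ 0 := by
    rw [charPoly, finsetSum_coeff, Finset.sum_eq_single k]
    · rw [coeff_C_mul, coeff_X_pow, if_pos rfl, mul_one]
      exact leadCoeff_ne_zero (mem_opSupport.1 (Finset.mem_filter.1 hk).1)
    · intro l hl hlk
      rw [coeff_C_mul, coeff_X_pow, if_neg, mul_zero]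
      have := (Finset.mem_filter.1 hk).2.2
      have := (Finset.mem_filter.1 hl).2.2
      omega
    · exact fun h => absurd hk h
  constructor
  · have hle : (charPoly P e).natDegree ≤ (e.2 - e.1).toNat := by
      refine natDegree_sum_le_of_forall_le _ _ fun k hk => (natDegree_C_mul_X_pow_le _ _).trans ?_
      have := (Finset.mem_filter.1 hk).2.2
      omega
    have hge := le_natDegree_of_ne_zero (hcoeff (k := e.2)
      (Finset.mem_filter.2 ⟨hj, mul_comm _ _, hij.le, le_rfl⟩))
    omega
  · simpa using hcoeff (k := e.1) (Finset.mem_filter.2 ⟨hi, by simp [OnLine], le_rfl, hij.le⟩)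

theorem card_aroots_charPoly {e : ℤ × ℤ} (he : e ∈ newtonEdges P) :
    (((charPoly P e).aroots ℂ).card : ℤ) = e.2 - e.1 := by
  rw [← (natDegree_charPoly_and_coeff_zero he).1, aroots_def,
    ← (IsAlgClosed.splits ((charPoly P e).map (algebraMap ℚ ℂ))).natDegree_eq_card_roots, natDegree_map]

theorem ne_zero_of_mem_aroots_charPoly {e : ℤ × ℤ} (he : e ∈ newtonEdges P) {z : ℂ}
    (hz : z ∈ (charPoly P e).aroots ℂ) : z ≠ 0 := by
  rintro rfl
  have h := (mem_aroots.1 hz).2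
  rw [← coeff_zero_eq_aeval_zero', _root_.map_eq_zero] at h
  exact (natDegree_charPoly_and_coeff_zero he).2 h

theorem charPoly_ne_zero {e : ℤ × ℤ} (he : e ∈ newtonEdges P) : charPoly P e ≠ 0 := by
  intro h
  apply (natDegree_charPoly_and_coeff_zero he).2
  simp [h]

-- With integer exponents, the mirror symmetry `k ↦ -k` becomes a plain reindexing.
open Classical in
theorem aeval_charPoly (e : ℤ × ℤ) (z : ℂ) :
    aeval z (charPoly P e) =
      ∑ k ∈ (opSupport P).filter fun k => OnLine P e.1 e.2 k ∧ e.1 ≤ k ∧ k ≤ e.2,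
        (leadCoeff (opCoeff P k) : ℂ) * z ^ (k - e.1) := by
  rw [charPoly, map_sum]
  refine Finset.sum_congr rfl fun k hk => ?_
  have : ((k - e.1).toNat : ℤ) = k - e.1 := by
    have := (Finset.mem_filter.1 hk).2.2
    omega
  rw [map_mul, aeval_C, map_pow, aeval_X, ← zpow_natCast, this]
  simp

end

/-! ### Mirror symmetry of edges and of their roots -/

section Symmetric

variable {P : RecOp} {ε : ℚ}

theorem leadCoeff_opCoeff_neg (hP : ∀ k, opCoeff P (-k) = RatFunc.C ε * reflect (opCoeff P k))
    (k : ℤ) : leadCoeff (opCoeff P (-k)) = ε * (-1) ^ height P k * leadCoeff (opCoeff P k) := by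
  rw [hP, leadCoeff_mul, leadCoeff_C, leadCoeff_reflect, height, zpow_neg, ← inv_zpow]
  norm_num
  ring

theorem height_neg (hε : ε = 1 ∨ ε = -1)
    (hP : ∀ k, opCoeff P (-k) = RatFunc.C ε * reflect (opCoeff P k)) (k : ℤ) :
    height P (-k) = height P k := by
  rw [height, height, hP]
  rcases hε with rfl | rfl
  · rw [map_one, one_mul, intDegree_reflect]
  · rw [map_neg, map_one, neg_one_mul, RatFunc.intDegree_neg, intDegree_reflect]

theorem neg_mem_opSupport (hε : ε = 1 ∨ ε = -1)
    (hP : ∀ k, opCoeff P (-k) = RatFunc.C ε * reflect (opCoeff P k)) {k : ℤ} :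
    -k ∈ opSupport P ↔ k ∈ opSupport P := by
  have : ε ≠ 0 := by rcases hε with rfl | rfl <;> norm_num
  rw [mem_opSupport, mem_opSupport, hP, mul_ne_zero_iff, _root_.map_ne_zero, _root_.map_ne_zero,
    and_iff_right this]

theorem onLine_neg (hε : ε = 1 ∨ ε = -1)
    (hP : ∀ k, opCoeff P (-k) = RatFunc.C ε * reflect (opCoeff P k)) {i j k : ℤ} :
    OnLine P (-j) (-i) (-k) ↔ OnLine P i j k := by
  simp only [OnLine, height_neg hε hP]
  constructor <;> intro h <;> linear_combination h

theorem aboveLine_neg (hε : ε = 1 ∨ ε = -1)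
    (hP : ∀ k, opCoeff P (-k) = RatFunc.C ε * reflect (opCoeff P k)) {i j k : ℤ} :
    AboveLine P (-j) (-i) (-k) ↔ AboveLine P i j k := by
  simp only [AboveLine, height_neg hε hP]
  constructor <;> intro h <;> linear_combination h

/-- The reflected segment. -/
def reflectEdge (e : ℤ × ℤ) : ℤ × ℤ := (-e.2, -e.1)

theorem reflectEdge_reflectEdge (e : ℤ × ℤ) : reflectEdge (reflectEdge e) = e := by
  simp [reflectEdge]

theorem reflectEdge_mem_newtonEdges (hε : ε = 1 ∨ ε = -1)
    (hP : ∀ k, opCoeff P (-k) = RatFunc.C ε * reflect (opCoeff P k)) {e : ℤ × ℤ}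
    (he : e ∈ newtonEdges P) : reflectEdge e ∈ newtonEdges P := by
  rw [mem_newtonEdges] at he ⊢
  obtain ⟨hi, hj, hij, h⟩ := he
  refine ⟨(neg_mem_opSupport hε hP).2 hj, (neg_mem_opSupport hε hP).2 hi, neg_lt_neg hij,
    fun k hk => ?_⟩
  obtain ⟨k, rfl⟩ := neg_surjective k
  rw [reflectEdge, aboveLine_neg hε hP, onLine_neg hε hP, neg_le_neg_iff, neg_le_neg_iff]
  exact (h k ((neg_mem_opSupport hε hP).1 hk)).imp_right fun h => ⟨h.1, h.2.2, h.2.1⟩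

theorem slope_reflectEdge (hε : ε = 1 ∨ ε = -1)
    (hP : ∀ k, opCoeff P (-k) = RatFunc.C ε * reflect (opCoeff P k)) (e : ℤ × ℤ) :
    slope P (reflectEdge e) = -slope P e := by
  simp only [slope, reflectEdge, height_neg hε hP]
  push_cast
  ring

/-- The characteristic polynomial of the reflected edge is, up to a constant, the reciprocal
polynomial evaluated on a rotated variable. -/
theorem exists_aeval_charPoly_reflectEdge (hε : ε = 1 ∨ ε = -1)
    (hP : ∀ k, opCoeff P (-k) = RatFunc.C ε * reflect (opCoeff P k)) {e : ℤ × ℤ}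
    (he : e ∈ newtonEdges P) :
    ∃ ζ c : ℂ, ‖ζ‖ = 1 ∧ ∀ z : ℂ, z ≠ 0 →
      aeval z (charPoly P (reflectEdge e)) =
        c * z ^ (e.2 - e.1) * aeval (ζ / z) (charPoly P e) := by
  classical
  obtain ⟨hi, hj, hij, -⟩ := mem_newtonEdges.1 he
  -- `ζ` stands for `(-1) ^ κ`. The slope may be a fraction, but `κ (k - i)` is a difference of
  -- heights for `p_k` on the edge, so `ζ ^ (k - i)` is a sign.
  refine ⟨Complex.exp ((slope P e * Real.pi : ℝ) * Complex.I), ε * (-1) ^ height P e.1,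
    Complex.norm_exp_ofReal_mul_I _, fun z hz => ?_⟩
  rw [aeval_charPoly, aeval_charPoly, Finset.mul_sum]
  refine Finset.sum_nbij' (fun k => -k) (fun k => -k) ?_ ?_ (by simp) (by simp) ?_
  · intro k hk
    obtain ⟨k, rfl⟩ := neg_surjective k
    rw [Finset.mem_filter] at hk ⊢
    simp only [reflectEdge, neg_mem_opSupport hε hP, onLine_neg hε hP, neg_neg,
      neg_le_neg_iff] at hk ⊢
    tauto
  · intro k hk
    rw [Finset.mem_filter] at hk ⊢
    simp only [reflectEdge, neg_mem_opSupport hε hP, onLine_neg hε hP, neg_le_neg_iff]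
    tauto
  · intro k hk
    obtain ⟨k, rfl⟩ := neg_surjective k
    rw [Finset.mem_filter] at hk
    simp only [reflectEdge, neg_mem_opSupport hε hP, onLine_neg hε hP, neg_neg] at hk ⊢
    have hline := (onLine_iff P hij k).1 hk.2.1
    have hexp : Complex.exp ((slope P e * Real.pi : ℝ) * Complex.I) ^ (k - e.1) =
        (-1) ^ (height P k - height P e.1) := by
      rw [← Complex.exp_int_mul, ← Complex.exp_pi_mul_I, ← Complex.exp_int_mul]
      congr 1
      have h : (height P k : ℂ) = height P e.1 + slope P e * (k - e.1) := by
        exact_mod_cast congrArg (Rat.cast : ℚ → ℂ) hline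
      push_cast
      rw [h]
      ring
    rw [leadCoeff_opCoeff_neg hP, div_zpow, hexp, zpow_sub₀ (by norm_num : (-1 : ℂ) ≠ 0),
      show -k - -e.2 = (e.2 - e.1) - (k - e.1) by ring, zpow_sub₀ hz]
    push_cast
    field_simp

/-- Factor by factor, `z (ζ / z - ρ) = -ρ (z - ζ / ρ)`. This turns the value at `ζ / z` into a
product over the new roots. -/
theorem pow_card_mul_prod_div_sub {R : Multiset ℂ} {ζ z : ℂ} (hz : z ≠ 0) (hR : ∀ ρ ∈ R, ρ ≠ 0) :
    z ^ R.card * (R.map fun ρ => ζ / z - ρ).prod =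
      (R.map fun ρ => -ρ).prod * (R.map fun ρ => z - ζ / ρ).prod := by
  induction R using Multiset.induction_on with
  | empty => simp
  | cons ρ R ih =>
    have hρ : ρ ≠ 0 := hR ρ (Multiset.mem_cons_self _ _)
    simp only [Multiset.map_cons, Multiset.prod_cons, Multiset.card_cons]
    have h1 : z * (ζ / z - ρ) = -ρ * (z - ζ / ρ) := by field_simp; ring
    linear_combination (z * (ζ / z - ρ)) * ih (fun w hw => hR w (Multiset.mem_cons_of_mem hw)) +
      (R.map fun ρ => -ρ).prod * (R.map fun ρ => z - ζ / ρ).prod * h1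

theorem aroots_charPoly_reflectEdge (hε : ε = 1 ∨ ε = -1)
    (hP : ∀ k, opCoeff P (-k) = RatFunc.C ε * reflect (opCoeff P k)) {e : ℤ × ℤ}
    (he : e ∈ newtonEdges P) :
    ∃ ζ : ℂ, ‖ζ‖ = 1 ∧
      (charPoly P (reflectEdge e)).aroots ℂ = ((charPoly P e).aroots ℂ).map fun z => ζ / z := by
  obtain ⟨ζ, c, hζ, h⟩ := exists_aeval_charPoly_reflectEdge hε hP he
  refine ⟨ζ, hζ, ?_⟩
  set R := (charPoly P e).aroots ℂ with hR
  set d : ℂ := c * (charPoly P e).leadingCoeff * (R.map fun ρ => -ρ).prod with hd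
  have heval (z : ℂ) (hz : z ≠ 0) : aeval z (charPoly P (reflectEdge e)) =
      d * ((R.map fun ρ => ζ / ρ).map fun w => z - w).prod := by
    have hN : e.2 - e.1 = (R.card : ℤ) := (card_aroots_charPoly he).symm
    have hsplit := (IsAlgClosed.splits ((charPoly P e).map (algebraMap ℚ ℂ))).eq_prod_roots
    have hev : aeval (ζ / z) (charPoly P e) =
        (charPoly P e).leadingCoeff * (R.map fun ρ => ζ / z - ρ).prod := by
      rw [← eval_map_algebraMap, hsplit, eval_mul, eval_C, eval_multiset_prod, Multiset.map_map]
      simp [hR, aroots_def]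
    rw [h z hz, hev, hN, zpow_natCast, Multiset.map_map, hd, mul_assoc _ (Multiset.prod _)]
    simp only [Function.comp_apply]
    rw [← pow_card_mul_prod_div_sub hz fun ρ hρ => ne_zero_of_mem_aroots_charPoly he hρ]
    ring
  have hpoly : (charPoly P (reflectEdge e)).map (algebraMap ℚ ℂ) =
      C d * ((R.map fun ρ => ζ / ρ).map fun w => X - C w).prod := by
    -- The substitution `ζ / z` excludes `z = 0`, but agreement at infinitely many points suffices.
    refine eq_of_infinite_eval_eq _ _ (Set.Infinite.mono (s := {0}ᶜ) (fun z hz => ?_)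
      (Set.finite_singleton (0 : ℂ)).infinite_compl)
    rw [Set.mem_ofPred_eq, eval_map_algebraMap, heval z hz, eval_mul, eval_C, eval_multiset_prod,
      Multiset.map_map]
    simp
  have hd0 : d ≠ 0 := by
    rintro h0
    rw [h0, C_0, zero_mul, Polynomial.map_eq_zero] at hpoly
    exact charPoly_ne_zero (reflectEdge_mem_newtonEdges hε hP he) hpoly
  rw [aroots_def, hpoly, roots_C_mul _ hd0, roots_multiset_prod_X_sub_C]

end Symmetric

/-! ### Decreasing enumerations of multisets -/

/-- Two decreasing enumerations of a multiset agree. -/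
theorem eqOn_of_antitoneOn_of_map_eq {α β : Type*} [LinearOrder α] [LinearOrder β] {s : Finset α}
    {f g : α → β} (hf : AntitoneOn f s) (hg : AntitoneOn g s) (h : s.val.map f = s.val.map g) :
    ∀ i ∈ s, f i = g i := by
  have hsort {f : α → β} (hf : AntitoneOn f s) : ((s.sort (· ≤ ·)).map f).Pairwise (· ≥ ·) := by
    rw [List.pairwise_map]
    refine (s.pairwise_sort (· ≤ ·)).imp_of_mem fun hi hj hij => ?_
    exact hf ((Finset.mem_sort _).1 hi) ((Finset.mem_sort _).1 hj) hij
  have hperm : ((s.sort (· ≤ ·)).map f).Perm ((s.sort (· ≤ ·)).map g) := by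
    rw [← Multiset.coe_eq_coe, ← Multiset.map_coe, ← Multiset.map_coe, Finset.sort_eq, h]
  have := hperm.eq_of_pairwise' (hsort hf) (hsort hg)
  exact fun i hi => List.map_inj_left.1 this i ((Finset.mem_sort _).2 hi)

/-- A multiset has an enumeration by any finset of its cardinality that is decreasing with respect to
a given function. -/
theorem exists_map_eq_antitoneOn {α β γ : Type*} [LinearOrder α] [LinearOrder γ] [Nonempty β]
    {s : Finset α} {M : Multiset β} (key : β → γ) (h : M.card = s.card) :
    ∃ f : α → β, s.val.map f = M ∧ AntitoneOn (key ∘ f) s := by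
  classical
  let L := M.toList.mergeSort fun x y => decide (key y ≤ key x)
  have hL : (L : Multiset β) = M := by
    rw [← Multiset.coe_toList M, Multiset.coe_eq_coe]
    exact List.mergeSort_perm _ _
  have hpw : L.Pairwise fun x y => key y ≤ key x := by
    have := List.pairwise_mergeSort (le := fun x y : β => decide (key y ≤ key x))
      (fun a b c => by simpa using fun h1 h2 => h2.trans h1)
      (fun a b => by simpa using le_total _ _) M.toList
    simpa using this
  have hlen : L.length = s.card := by rw [← h, ← hL, Multiset.coe_card]
  let S := s.sort (· ≤ ·)
  have hSlen : S.length = s.card := Finset.length_sort _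
  let b : β := Classical.arbitrary β
  have hmap : S.map (fun i => L.getD (S.idxOf i) b) = L := by
    refine List.ext_getElem (by simp [hSlen, hlen]) fun n h1 h2 => ?_
    rw [List.getElem_map, (s.sort_nodup (· ≤ ·)).idxOf_getElem, List.getD_eq_getElem _ _ h2]
  refine ⟨fun i => L.getD (S.idxOf i) b, ?_, ?_⟩
  · rw [← Finset.sort_eq s (· ≤ ·), Multiset.map_coe, hmap, hL]
  · intro i hi j hj hij
    have hi' : S.idxOf i < S.length := List.idxOf_lt_length_of_mem ((Finset.mem_sort _).2 hi)
    have hj' : S.idxOf j < S.length := List.idxOf_lt_length_of_mem ((Finset.mem_sort _).2 hj)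
    rcases hij.eq_or_lt with rfl | hlt
    · exact le_rfl
    have hidx : S.idxOf i < S.idxOf j := by
      by_contra! hle
      rcases hle.eq_or_lt with heq | hlt'
      · exact hlt.ne ((List.idxOf_inj ((Finset.mem_sort _).2 hj)).1 heq).symm
      · have := List.pairwise_iff_getElem.1 (s.pairwise_sort (· ≤ ·)) _ _ hj' hi' hlt'
        rw [List.getElem_idxOf, List.getElem_idxOf] at this
        exact hlt.not_ge this
    simp only [Function.comp]
    rw [List.getD_eq_getElem _ _ (by omega), List.getD_eq_getElem _ _ (by omega)]
    exact List.pairwise_iff_getElem.1 hpw _ _ _ _ hidx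

/-! ### Counting and enumerating the roots -/

theorem card_indexSet (P : RecOp) : (indexSet P).card = 2 * halfOrder P := by
  rw [indexSet, Finset.card_erase_of_mem (by simp), Int.card_Icc]
  omega

theorem neg_mem_indexSet {P : RecOp} {i : ℤ} : -i ∈ indexSet P ↔ i ∈ indexSet P := by
  simp only [indexSet, Finset.mem_erase, Finset.mem_Icc]
  omega

theorem mem_newtonRoots {P : RecOp} {x : ℚ × ℂ} :
    x ∈ newtonRoots P ↔ ∃ e ∈ newtonEdges P, x.2 ∈ (charPoly P e).aroots ℂ ∧ slope P e = x.1 := by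
  simp only [newtonRoots, Multiset.mem_sum, Multiset.mem_map]
  refine exists_congr fun e => and_congr_right fun _ => ?_
  exact ⟨by rintro ⟨z, h, rfl⟩; exact ⟨h, rfl⟩, fun h => ⟨x.2, h.1, by rw [h.2]⟩⟩

section Symmetric

variable {P : RecOp} {ε : ℚ}

theorem card_newtonRoots (hε : ε = 1 ∨ ε = -1)
    (hP : ∀ k, opCoeff P (-k) = RatFunc.C ε * reflect (opCoeff P k)) :
    (newtonRoots P).card = 2 * halfOrder P := by
  have hsum : ((newtonRoots P).card : ℤ) = ∑ e ∈ newtonEdges P, (e.2 - e.1) := by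
    rw [newtonRoots, Multiset.card_sum]
    push_cast
    refine Finset.sum_congr rfl fun e he => ?_
    rw [Multiset.card_map, card_aroots_charPoly he]
  -- For `P = 0` there are no edges, and the half-order is `0`, the supremum of the empty set.
  rcases (opSupport P).eq_empty_or_nonempty with h0 | hne
  · have h1 : newtonEdges P = ∅ := by
      refine Finset.eq_empty_of_forall_notMem fun e he => ?_
      have := (mem_newtonEdges.1 he).1
      simp [h0] at this
    have h2 : halfOrder P = 0 := by simp [halfOrder, h0]
    rw [h1, Finset.sum_empty] at hsum
    omega
  · obtain ⟨k, hk, hks⟩ := (opSupport P).exists_mem_eq_sup hne Int.natAbs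
    have hle : ∀ l ∈ opSupport P, -(halfOrder P : ℤ) ≤ l ∧ l ≤ halfOrder P := fun l hl => by
      have : l.natAbs ≤ halfOrder P := Finset.le_sup (f := Int.natAbs) hl
      omega
    have hk' : k.natAbs = halfOrder P := hks.symm
    -- Only one of `±s` is known to attain the maximum. Symmetry supplies the other, so the width is
    -- `2s`.
    have hmem : (halfOrder P : ℤ) ∈ opSupport P ∧ -(halfOrder P : ℤ) ∈ opSupport P := by
      rw [neg_mem_opSupport hε hP, and_self, ← hk']
      rcases Int.natAbs_eq k with h | h
      · rwa [← h]
      · rwa [← neg_mem_opSupport hε hP, ← h]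
    rw [sum_newtonEdges P hmem.2 hmem.1 hle] at hsum
    omega

/-- The roots with their slopes are symmetric, as far as moduli are concerned. -/
theorem map_newtonRoots_symm (hε : ε = 1 ∨ ε = -1)
    (hP : ∀ k, opCoeff P (-k) = RatFunc.C ε * reflect (opCoeff P k)) :
    (newtonRoots P).map (fun x => toLex (-x.1, ‖x.2‖⁻¹)) =
      (newtonRoots P).map (fun x => toLex (x.1, ‖x.2‖)) := by
  have hmap {β : Type} (f : ℚ × ℂ → β) : (newtonRoots P).map f =
      ∑ e ∈ newtonEdges P, ((charPoly P e).aroots ℂ).map fun z => f (slope P e, z) := by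
    rw [newtonRoots, ← Multiset.coe_mapAddMonoidHom, map_sum]
    refine Finset.sum_congr rfl fun e _ => ?_
    rw [Multiset.coe_mapAddMonoidHom, Multiset.map_map]
    rfl
  rw [hmap, hmap]
  refine Finset.sum_nbij' reflectEdge reflectEdge
    (fun e he => reflectEdge_mem_newtonEdges hε hP he)
    (fun e he => reflectEdge_mem_newtonEdges hε hP he)
    (fun e _ => reflectEdge_reflectEdge e) (fun e _ => reflectEdge_reflectEdge e) fun e he => ?_
  obtain ⟨ζ, hζ, h⟩ := aroots_charPoly_reflectEdge hε hP he
  rw [h, slope_reflectEdge hε hP, Multiset.map_map]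
  simp [hζ]

/-- The ordering condition says that `(κ, |α|)` decreases lexicographically as the index grows, so
sorting by this key gives an enumeration. -/
theorem exists_isRootEnumeration (hε : ε = 1 ∨ ε = -1)
    (hP : ∀ k, opCoeff P (-k) = RatFunc.C ε * reflect (opCoeff P k)) :
    ∃ κ α, IsRootEnumeration P κ α := by
  obtain ⟨f, hf, hanti⟩ := exists_map_eq_antitoneOn (s := indexSet P) (M := newtonRoots P)
    (fun x => toLex (x.1, ‖x.2‖)) (by rw [card_newtonRoots hε hP, card_indexSet])
  refine ⟨fun i => (f i).1, fun i => (f i).2, hf, fun i hi j hj hji => ?_⟩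
  exact Prod.Lex.le_iff.1 (hanti hj hi hji.le)

theorem IsRootEnumeration.mem {κ : ℤ → ℚ} {α : ℤ → ℂ} (h : IsRootEnumeration P κ α) {i : ℤ}
    (hi : i ∈ indexSet P) : (κ i, α i) ∈ newtonRoots P := by
  rw [← h.roots]
  exact Multiset.mem_map_of_mem _ hi

/-- The enumeration and its mirror image are both decreasing for the lexicographic order and list
the same multiset of pairs, so they coincide. Positivity of the moduli makes inversion
order-reversing. -/
theorem IsRootEnumeration.symm {κ : ℤ → ℚ} {α : ℤ → ℂ} (h : IsRootEnumeration P κ α)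
    (hε : ε = 1 ∨ ε = -1) (hP : ∀ k, opCoeff P (-k) = RatFunc.C ε * reflect (opCoeff P k)) {i : ℤ}
    (hi : i ∈ indexSet P) : κ (-i) = -κ i ∧ ‖α (-i)‖ = ‖α i‖⁻¹ := by
  have hpos {i : ℤ} (hi : i ∈ indexSet P) : 0 < ‖α i‖ := by
    obtain ⟨e, he, hz, -⟩ := mem_newtonRoots.1 (h.mem hi)
    exact norm_pos_iff.2 (ne_zero_of_mem_aroots_charPoly he hz)
  have hle {i j : ℤ} (hi : i ∈ indexSet P) (hj : j ∈ indexSet P) (hji : j ≤ i) :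
      κ i < κ j ∨ (κ i = κ j ∧ ‖α i‖ ≤ ‖α j‖) := by
    rcases hji.eq_or_lt with rfl | hlt
    · exact Or.inr ⟨rfl, le_rfl⟩
    · exact h.ordered i hi j hj hlt
  have hf : AntitoneOn (fun i => toLex (κ i, ‖α i‖)) (indexSet P) := fun j hj i hi hji =>
    Prod.Lex.le_iff.2 (hle hi hj hji)
  have hg : AntitoneOn (fun i => toLex (-κ (-i), ‖α (-i)‖⁻¹)) (indexSet P) := by
    intro j hj i hi hji
    have hj' := neg_mem_indexSet.2 hj
    have hi' := neg_mem_indexSet.2 hi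
    refine Prod.Lex.le_iff.2 ((hle hj' hi' (neg_le_neg hji)).imp (fun h => neg_lt_neg h) ?_)
    exact fun h => ⟨congrArg Neg.neg h.1.symm, inv_anti₀ (hpos hj') h.2⟩
  have hneg : (indexSet P).val.map (fun i => -i) = (indexSet P).val := by
    have : (indexSet P).map (Equiv.neg ℤ).toEmbedding = indexSet P := by
      ext i
      simp only [Finset.mem_map_equiv]
      exact neg_mem_indexSet
    exact congrArg Finset.val this
  have hmap : (indexSet P).val.map (fun i => toLex (κ i, ‖α i‖)) =
      (indexSet P).val.map (fun i => toLex (-κ (-i), ‖α (-i)‖⁻¹)) := by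
    have h1 := map_newtonRoots_symm hε hP
    rw [← h.roots, Multiset.map_map, Multiset.map_map] at h1
    refine h1.symm.trans ?_
    conv_lhs => rw [← hneg, Multiset.map_map]
    rfl
  have := eqOn_of_antitoneOn_of_map_eq hf hg hmap (-i) (neg_mem_indexSet.2 hi)
  simpa using this

end Symmetric

/-! ### The horizontal edge -/

/-- A horizontal edge has the characteristic polynomial `a_r((z + z⁻¹) / 2)`, up to a factor, which
has no root on the unit circle. -/
theorem norm_ne_one_of_slope_eq_zero {r : ℕ} {a : Fin (r + 1) → ℚ[X]}
    (ha : ∀ x : ℝ, x ∈ Set.Icc (-1 : ℝ) 1 → aeval x (a (Fin.last r)) ≠ 0) {e : ℤ × ℤ}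
    (he : e ∈ newtonEdges (chebyshevOp a)) (hs : slope (chebyshevOp a) e = 0) {z : ℂ}
    (hz : z ∈ (charPoly (chebyshevOp a) e).aroots ℂ) : ‖z‖ ≠ 1 := by
  classical
  intro hz1
  obtain ⟨u, hu, hcoeff⟩ := exists_opCoeff_chebyshevOp a
  set P := chebyshevOp a
  have hcircle {w : ℂ} (hw : ‖w‖ = 1) : (u.sum fun k c => (c : ℂ) * w ^ k) ≠ 0 := by
    have hw0 : w ≠ 0 := norm_ne_zero_iff.1 (by rw [hw]; exact one_ne_zero)
    have hre : (w + w⁻¹) / 2 = algebraMap ℝ ℂ w.re := by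
      rw [Complex.inv_eq_conj hw, Complex.add_conj]
      simp
    rw [hu w hw0, hre, aeval_algebraMap_apply, _root_.map_ne_zero]
    exact ha _ (abs_le.1 (hw ▸ Complex.abs_re_le_norm w))
  -- The points with `u k ≠ 0` have height exactly `-deg δ_r`; all others are strictly higher.
  have htop {k : ℤ} (hk : u k ≠ 0) :
      k ∈ opSupport P ∧ height P k = -(delta r).intDegree ∧
        leadCoeff (opCoeff P k) = leadCoeff (delta r) * u k := by
    obtain ⟨g, hg, hg'⟩ := hcoeff k
    have hlim := leadCoeff_eq_of_intDegree_sub_neg (f := RatFunc.C (u k) + g) hk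
      (by simpa using hg')
    have hne : RatFunc.C (u k) + g ≠ 0 := by
      intro h0
      rw [h0, leadCoeff, RatFunc.num_zero, leadingCoeff_zero, zero_div] at hlim
      exact hk hlim.2.symm
    rw [mem_opSupport, height, hg]
    refine ⟨mul_ne_zero (delta_ne_zero r) hne, ?_, ?_⟩
    · rw [RatFunc.intDegree_mul (delta_ne_zero r) hne, hlim.1, add_zero]
    · rw [leadCoeff_mul, hlim.2]
  have hlow {k : ℤ} (hk : k ∈ opSupport P) (hk0 : u k = 0) :
      -(delta r).intDegree < height P k := by
    obtain ⟨g, hg, hg'⟩ := hcoeff k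
    rw [hk0, map_zero, zero_add] at hg
    rw [mem_opSupport, hg] at hk
    have hg0 := right_ne_zero_of_mul hk
    rw [height, hg, RatFunc.intDegree_mul (delta_ne_zero r) hg0]
    have := hg'.resolve_left hg0
    omega
  -- The Laurent polynomial of `u` does not vanish at `1`, so the minimal height is attained.
  obtain ⟨k₀, hk₀⟩ : ∃ k, u k ≠ 0 := by
    by_contra! h0
    have : u = 0 := Finsupp.ext h0
    exact hcircle (w := 1) (by simp) (by simp [this])
  have hmem := mem_newtonEdges.1 he
  obtain ⟨hi, hj, hij, -, hline⟩ := (isNewtonEdge_iff P _ _).1 hmem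
  rw [Prod.mk.eta, hs] at hline
  simp only [zero_mul, add_zero, Int.cast_le, Int.cast_inj] at hline
  have hheight : height P e.1 = -(delta r).intDegree := by
    have h1 := (hline k₀ (htop hk₀).1).1
    rw [(htop hk₀).2.1] at h1
    rcases eq_or_ne (u e.1) 0 with h0 | h0
    · have := hlow hi h0
      omega
    · exact (htop h0).2.1
  -- The horizontal edge lies at minimal height, so its points are exactly those with `u k ≠ 0`.
  have hset : ((opSupport P).filter fun k => OnLine P e.1 e.2 k ∧ e.1 ≤ k ∧ k ≤ e.2) =
      u.support := by
    ext k
    rw [Finset.mem_filter, onLine_iff P hij, Prod.mk.eta, hs, Finsupp.mem_support_iff]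
    simp only [zero_mul, add_zero, Int.cast_inj]
    constructor
    · rintro ⟨hk, hk', -⟩ h0
      have := hlow hk h0
      omega
    · intro hk
      have hk' : height P k = height P e.1 := by rw [(htop hk).2.1, hheight]
      exact ⟨(htop hk).1, hk', (hline k (htop hk).1).2 hk'⟩
  have hz0 : z ≠ 0 := norm_ne_zero_iff.1 (by rw [hz1]; exact one_ne_zero)
  have heval : aeval z (charPoly P e) =
      leadCoeff (delta r) * z ^ (-e.1) * u.sum fun k c => (c : ℂ) * z ^ k := by
    rw [aeval_charPoly, hset, Finsupp.sum, Finset.mul_sum]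
    refine Finset.sum_congr rfl fun k hk => ?_
    rw [(htop (Finsupp.mem_support_iff.1 hk)).2.2, sub_eq_neg_add, zpow_add₀ hz0]
    push_cast
    ring
  rw [(mem_aroots.1 hz).2] at heval
  exact mul_ne_zero (mul_ne_zero (Rat.cast_ne_zero.2 (leadCoeff_ne_zero (delta_ne_zero r)))
    (zpow_ne_zero _ hz0)) (hcircle hz1) heval.symm

end ChebyshevRecurrence

end

theorem mainTheorem9 (r : ℕ) (a : Fin (r + 1) → ℚ[X])
    (ha : ∀ x : ℝ, x ∈ Set.Icc (-1 : ℝ) 1 → aeval x (a (Fin.last r)) ≠ 0) :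
    (∃ (κ : ℤ → ℚ) (α : ℤ → ℂ),
      ChebyshevRecurrence.IsRootEnumeration (ChebyshevRecurrence.chebyshevOp a) κ α) ∧
    ∀ (κ : ℤ → ℚ) (α : ℤ → ℂ),
      ChebyshevRecurrence.IsRootEnumeration (ChebyshevRecurrence.chebyshevOp a) κ α →
      ∀ i ∈ ChebyshevRecurrence.indexSet (ChebyshevRecurrence.chebyshevOp a),
        κ (-i) = -κ i ∧ ‖α (-i)‖ = ‖α i‖⁻¹ ∧ (κ i = 0 → ‖α i‖ ≠ 1) := by
  obtain ⟨ε, hε, hP⟩ := ChebyshevRecurrence.opCoeff_chebyshevOp_neg a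
  refine ⟨ChebyshevRecurrence.exists_isRootEnumeration hε hP, fun κ α h i hi => ?_⟩
  obtain ⟨h1, h2⟩ := h.symm hε hP hi
  refine ⟨h1, h2, fun h0 => ?_⟩
  obtain ⟨e, he, hz, hs⟩ := ChebyshevRecurrence.mem_newtonRoots.1 (h.mem hi)
  exact ChebyshevRecurrence.norm_ne_one_of_slope_eq_zero ha he (hs.trans h0) hz
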